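/- Let $p$ be a prime, and let $\mathcal{M}_{\mathrm{fg}}$ be the moduli stack of (commutative, one-dimensional) formal groups over $p$-local rings, i.e. the stack over $\operatorname{Spec}\mathbb{Z}_{(p)}$ associated, for the fpqc topology, to the prestack sending a $\mathbb{Z}_{(p)}$-algebra $R$ to the groupoid of formal group laws over $R$ and their isomorphisms. Let $\omega$ be the line bundle on $\mathcal{M}_{\mathrm{fg}}$ sending a formal group to the dual of its Lie algebra. For $s\ge 0$ and $u\in\mathbb{Z}$ let $$E_2^{s,2u}=\mathrm{H}^s(\mathcal{M}_{\mathrm{fg}};\omega^{\otimes u})$$ be the ($p$-local) Adams–Novikov $E_2$-term, a $\mathbb{Z}_{(p)}$-module. For an abelian group $M$ let $\mathrm{tors}_p(M)\in\mathbb{N}\cup\{\infty\}$ be the least $k$ with $p^kM=0$ ($\infty$ if there is none), and let $v_p$ be the $p$-adic valuation on $\mathbb{Z}$, with $v_p(0)=\infty$. Then for all $s\geq 0$ and $u\in\mathbb{Z}$: 1. For every $\ell\in\mathbb{Z}_{(p)}^\times$, $\;(\ell^u-1)\cdot E_2^{s,2u}=0$. 2. If $p=2$, then $\mathrm{tors}_2(E_2^{s,2u})\le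 1$ for $u$ odd, and $\mathrm{tors}_2(E_2^{s,2u})\le 2+v_2(u)$ for $u$ even. 3. If $p$ is odd, then $\mathrm{tors}_p(E_2^{s,2u})=0$ if $(p-1)\nmid u$, and $\mathrm{tors}_p(E_2^{s,2u})\le 1+v_p(u)$ if $(p-1)\mid u$. -/

import Mathlib

open CategoryTheory
open scoped TensorProduct

noncomputable section

/-- A power series `f` over `R` is a homomorphism `F ⟶ G` of formal group laws:
`f(0) = 0` and `f(F(x, y)) = G(f(x), f(y))`. -/
def FormalGroup.IsHom {R : Type} [CommRing R] (F G : FormalGroup R) (f : PowerSeries R) : Prop :=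
  PowerSeries.constantCoeff f = 0 ∧
    PowerSeries.subst F.toPowerSeries f =
      MvPowerSeries.subst
        ![PowerSeries.subst (MvPowerSeries.X 0 : MvPowerSeries (Fin 2) R) f,
          PowerSeries.subst (MvPowerSeries.X 1 : MvPowerSeries (Fin 2) R) f]
        G.toPowerSeries

namespace FormalGroup

section

variable {R S : Type} [CommRing R] [CommRing S]

lemma hasSubst_law (F : FormalGroup R) : PowerSeries.HasSubst F.toPowerSeries :=
  PowerSeries.HasSubst.of_constantCoeff_zero F.zero_constantCoeff

lemma hasSubst_pair {f : PowerSeries R} (hf : PowerSeries.constantCoeff f = 0) :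
    MvPowerSeries.HasSubst
      ![PowerSeries.subst (MvPowerSeries.X 0 : MvPowerSeries (Fin 2) R) f,
        PowerSeries.subst (MvPowerSeries.X 1 : MvPowerSeries (Fin 2) R) f] := by
  apply MvPowerSeries.hasSubst_of_constantCoeff_zero
  intro i
  fin_cases i <;>
  exact PowerSeries.constantCoeff_subst_eq_zero (MvPowerSeries.constantCoeff_X _) _ hf

lemma subst_subst_one {σ τ : Type} {a : MvPowerSeries σ R} (ha : PowerSeries.HasSubst a)
    {b : σ → MvPowerSeries τ R} (hb : MvPowerSeries.HasSubst b) (f : PowerSeries R) :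
    MvPowerSeries.subst b (PowerSeries.subst a f) =
      PowerSeries.subst (MvPowerSeries.subst b a) f :=
  MvPowerSeries.subst_comp_subst_apply ha.const hb f

lemma subst_subst_pair {σ τ : Type} {x y : MvPowerSeries σ R}
    (hxy : MvPowerSeries.HasSubst ![x, y])
    {b : σ → MvPowerSeries τ R} (hb : MvPowerSeries.HasSubst b) (H : MvPowerSeries (Fin 2) R) :
    MvPowerSeries.subst b (MvPowerSeries.subst ![x, y] H) =
      MvPowerSeries.subst ![MvPowerSeries.subst b x, MvPowerSeries.subst b y] H := by
  rw [MvPowerSeries.subst_comp_subst_apply hxy hb]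
  congr 1
  ext1 i
  fin_cases i <;> rfl

lemma subst_X_pair (H : MvPowerSeries (Fin 2) R) :
    MvPowerSeries.subst ![(MvPowerSeries.X 0 : MvPowerSeries (Fin 2) R), MvPowerSeries.X 1] H =
      H := by
  have : ![(MvPowerSeries.X 0 : MvPowerSeries (Fin 2) R), MvPowerSeries.X 1] =
      MvPowerSeries.X := by
    ext1 i; fin_cases i <;> rfl
  rw [this, MvPowerSeries.subst_self]
  rfl

lemma IsHom.id (F : FormalGroup R) : IsHom F F PowerSeries.X := by
  refine ⟨PowerSeries.constantCoeff_X, ?_⟩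
  rw [PowerSeries.subst_X F.hasSubst_law, PowerSeries.subst_X (PowerSeries.HasSubst.X _),
    PowerSeries.subst_X (PowerSeries.HasSubst.X _), subst_X_pair]

lemma IsHom.comp {F G H : FormalGroup R} {f g : PowerSeries R} (hf : IsHom F G f)
    (hg : IsHom G H g) : IsHom F H (PowerSeries.subst f g) := by
  have hf' : PowerSeries.HasSubst f := PowerSeries.HasSubst.of_constantCoeff_zero' hf.1
  have hp := hasSubst_pair hf.1
  refine ⟨PowerSeries.constantCoeff_subst_eq_zero hf.1 _ hg.1, ?_⟩
  rw [PowerSeries.subst_comp_subst_apply hf' F.hasSubst_law,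
    PowerSeries.subst_comp_subst_apply hf' (PowerSeries.HasSubst.X _),
    PowerSeries.subst_comp_subst_apply hf' (PowerSeries.HasSubst.X _), hf.2,
    ← subst_subst_one G.hasSubst_law hp, hg.2, subst_subst_pair (hasSubst_pair hg.1) hp,
    subst_subst_one (PowerSeries.HasSubst.X _) hp, subst_subst_one (PowerSeries.HasSubst.X _) hp,
    MvPowerSeries.subst_X hp, MvPowerSeries.subst_X hp]
  rfl

lemma constantCoeff_map_zero (φ : R →+* S) {f : PowerSeries R}
    (hf : PowerSeries.constantCoeff f = 0) :
    PowerSeries.constantCoeff (PowerSeries.map φ f) = 0 := by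
  rw [← PowerSeries.coeff_zero_eq_constantCoeff_apply, PowerSeries.coeff_map,
    PowerSeries.coeff_zero_eq_constantCoeff_apply, hf, map_zero]

lemma IsHom.map {F G : FormalGroup R} {f : PowerSeries R} (hf : IsHom F G f) (φ : R →+* S) :
    IsHom (F.map φ) (G.map φ) (PowerSeries.map φ f) := by
  refine ⟨constantCoeff_map_zero φ hf.1, ?_⟩
  have h := congrArg (MvPowerSeries.map φ) hf.2
  rw [PowerSeries.map_subst F.hasSubst_law, MvPowerSeries.map_subst (hasSubst_pair hf.1)] at h
  rw [FormalGroup.map_toPowerSeries, FormalGroup.map_toPowerSeries, h]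
  congr 1
  ext1 i
  fin_cases i
  · simp only [Fin.zero_eta, Matrix.cons_val_zero]
    rw [PowerSeries.map_subst (PowerSeries.HasSubst.X _), MvPowerSeries.map_X]
  · simp only [Fin.mk_one, Matrix.cons_val_one, Matrix.cons_val_zero]
    rw [PowerSeries.map_subst (PowerSeries.HasSubst.X _), MvPowerSeries.map_X]

lemma map_map {T : Type} [CommRing T] (F : FormalGroup R) (φ : R →+* S) (ψ : S →+* T) :
    (F.map φ).map ψ = F.map (ψ.comp φ) := by
  ext1
  simp only [FormalGroup.map_toPowerSeries, MvPowerSeries.map_comp]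
  rfl

lemma map_id (F : FormalGroup R) : F.map (RingHom.id R) = F := by
  ext1
  simp

lemma isComm_map (F : FormalGroup R) [hF : F.IsComm] (φ : R →+* S) : (F.map φ).IsComm := by
  constructor
  have h := congrArg (MvPowerSeries.map φ) hF.comm
  have hs : MvPowerSeries.HasSubst
      ![(MvPowerSeries.X 1 : MvPowerSeries (Fin 2) R), MvPowerSeries.X 0] := by
    apply MvPowerSeries.hasSubst_of_constantCoeff_zero
    intro i
    fin_cases i <;> exact MvPowerSeries.constantCoeff_X _
  rw [MvPowerSeries.map_subst hs] at h
  rw [FormalGroup.map_toPowerSeries, h]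
  congr 1
  ext1 i
  fin_cases i <;> simp

/-- The compositional inverse of an invertible homomorphism is a homomorphism. -/
lemma IsHom.inv {F G : FormalGroup R} {f : PowerSeries R} (hf : IsHom F G f)
    (hu : IsUnit (PowerSeries.coeff 1 f)) :
    ∃ g : PowerSeries R, IsHom G F g ∧ IsUnit (PowerSeries.coeff 1 g) ∧
      PowerSeries.subst f g = PowerSeries.X ∧ PowerSeries.subst g f = PowerSeries.X := by
  let g := f.substInvOfIsUnit hu
  have hg0 : PowerSeries.constantCoeff g = 0 := PowerSeries.constantCoeff_substInvOfIsUnit f hu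
  have hgf : PowerSeries.subst f g = PowerSeries.X :=
    PowerSeries.subst_substInvOfIsUnit_left f hf.1 hu
  have hfg : PowerSeries.subst g f = PowerSeries.X :=
    PowerSeries.subst_substInvOfIsUnit_right f hf.1 hu
  have hf' : PowerSeries.HasSubst f := PowerSeries.HasSubst.of_constantCoeff_zero' hf.1
  have hg' : PowerSeries.HasSubst g := PowerSeries.HasSubst.of_constantCoeff_zero' hg0
  have hp := hasSubst_pair hg0
  refine ⟨g, ⟨hg0, ?_⟩, ?_, hgf, hfg⟩
  · have h := congrArg (MvPowerSeries.subst
        ![PowerSeries.subst (MvPowerSeries.X 0 : MvPowerSeries (Fin 2) R) g,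
          PowerSeries.subst (MvPowerSeries.X 1 : MvPowerSeries (Fin 2) R) g]) hf.2
    rw [subst_subst_one F.hasSubst_law hp, subst_subst_pair (hasSubst_pair hf.1) hp,
      subst_subst_one (PowerSeries.HasSubst.X _) hp, subst_subst_one (PowerSeries.HasSubst.X _) hp,
      MvPowerSeries.subst_X hp, MvPowerSeries.subst_X hp] at h
    simp only [Matrix.cons_val_zero, Matrix.cons_val_one] at h
    rw [← PowerSeries.subst_comp_subst_apply hg' (PowerSeries.HasSubst.X _),
      ← PowerSeries.subst_comp_subst_apply hg' (PowerSeries.HasSubst.X _), hfg,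
      PowerSeries.subst_X (PowerSeries.HasSubst.X _),
      PowerSeries.subst_X (PowerSeries.HasSubst.X _), subst_X_pair] at h
    have hF : PowerSeries.HasSubst (MvPowerSeries.subst
        ![PowerSeries.subst (MvPowerSeries.X 0 : MvPowerSeries (Fin 2) R) g,
          PowerSeries.subst (MvPowerSeries.X 1 : MvPowerSeries (Fin 2) R) g]
        F.toPowerSeries) := by
      apply PowerSeries.HasSubst.of_constantCoeff_zero
      apply MvPowerSeries.constantCoeff_subst_eq_zero hp
      · intro i
        fin_cases i <;>
        exact PowerSeries.constantCoeff_subst_eq_zero (MvPowerSeries.constantCoeff_X _) _ hg0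
      · exact F.zero_constantCoeff
    rw [← h, ← PowerSeries.subst_comp_subst_apply hf' hF, hgf, PowerSeries.subst_X hF]
  · rw [PowerSeries.coeff_one_substInvOfIsUnit]
    exact Units.isUnit _

lemma coeff_one_subst {f : PowerSeries R} (hf : PowerSeries.constantCoeff f = 0)
    (g : PowerSeries R) :
    PowerSeries.coeff 1 (PowerSeries.subst f g) =
      PowerSeries.coeff 1 f * PowerSeries.coeff 1 g := by
  rw [PowerSeries.coeff_subst' (PowerSeries.HasSubst.of_constantCoeff_zero' hf),
    finsum_eq_single _ 1]
  · simp [mul_comm]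
  · intro n hn
    rcases n with _ | _ | n
    · simp
    · simp at hn
    · have : PowerSeries.X ^ (n + 2) ∣ f ^ (n + 2) :=
        pow_dvd_pow_of_dvd (PowerSeries.X_dvd_iff.mpr hf) _
      rw [PowerSeries.X_pow_dvd_iff.mp this 1 (by omega), smul_zero]

end

end FormalGroup


section descent

variable {ι : Type} [Finite ι] {A : Type} [CommRing A] {B : ι → Type} [∀ i, CommRing (B i)]
  [∀ i, Algebra A (B i)]

lemma faithfullyFlat_pi (hflat : ∀ i, Module.Flat A (B i))
    (hsurj : ∀ P : PrimeSpectrum A, ∃ i, P ∈ Set.range (PrimeSpectrum.comap (algebraMap A (B i)))) :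
    Module.FaithfullyFlat A (∀ i, B i) := by
  classical
  have := Fintype.ofFinite ι
  have : Module.Flat A (∀ i, B i) :=
    Module.Flat.of_linearEquiv (DirectSum.linearEquivFunOnFintype A ι B).symm
  refine Module.FaithfullyFlat.of_comap_surjective fun P => ?_
  obtain ⟨i, Q, rfl⟩ := hsurj P
  exact ⟨PrimeSpectrum.comap (Pi.evalRingHom B i) Q, rfl⟩

lemma exists_mem_range_comap_baseChange {C : Type} [CommRing C] [Algebra A C]
    (hflat : ∀ i, Module.Flat A (B i))
    (hsurj : ∀ P : PrimeSpectrum A, ∃ i, P ∈ Set.range (PrimeSpectrum.comap (algebraMap A (B i))))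
    (P : PrimeSpectrum C) :
    ∃ i, P ∈ Set.range (PrimeSpectrum.comap (algebraMap C (C ⊗[A] B i))) := by
  classical
  have := Fintype.ofFinite ι
  have := faithfullyFlat_pi hflat hsurj
  obtain ⟨Q, rfl⟩ := PrimeSpectrum.comap_surjective_of_faithfullyFlat (A := C)
    (B := C ⊗[A] (∀ i, B i)) P
  let e := Algebra.TensorProduct.piRight A C C B
  obtain ⟨i, q, hq⟩ := PrimeSpectrum.exists_comap_evalRingHom_eq
    (PrimeSpectrum.comap (e.symm : (∀ i, C ⊗[A] B i) →+* C ⊗[A] (∀ i, B i)) Q)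
  refine ⟨i, q, ?_⟩
  have h1 : algebraMap C (C ⊗[A] B i) =
      ((Pi.evalRingHom (fun i => C ⊗[A] B i) i).comp
        (algebraMap C (∀ i, C ⊗[A] B i))) := rfl
  have h2 : algebraMap C (C ⊗[A] (∀ i, B i)) =
      (e.symm : (∀ i, C ⊗[A] B i) →+* C ⊗[A] (∀ i, B i)).comp
        (algebraMap C (∀ i, C ⊗[A] B i)) := by
    ext c
    exact (e.symm.commutes c).symm
  rw [h1, h2, PrimeSpectrum.comap_comp_apply, PrimeSpectrum.comap_comp_apply, hq]

lemma algebraMap_pi_injective (hflat : ∀ i, Module.Flat A (B i))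
    (hsurj : ∀ P : PrimeSpectrum A, ∃ i, P ∈ Set.range (PrimeSpectrum.comap (algebraMap A (B i))))
    {r s : A} (h : ∀ i, algebraMap A (B i) r = algebraMap A (B i) s) : r = s := by
  have := faithfullyFlat_pi hflat hsurj
  exact FaithfulSMul.algebraMap_injective A (∀ i, B i) (funext h)

lemma exists_algebraMap_eq (hflat : ∀ i, Module.Flat A (B i))
    (hsurj : ∀ P : PrimeSpectrum A, ∃ i, P ∈ Set.range (PrimeSpectrum.comap (algebraMap A (B i))))
    (y : ∀ i, B i) (hy : ∀ i j, y i ⊗ₜ[A] (1 : B j) = (1 : B i) ⊗ₜ[A] y j) :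
    ∃ r : A, ∀ i, algebraMap A (B i) r = y i := by
  classical
  have := Fintype.ofFinite ι
  have := faithfullyFlat_pi hflat hsurj
  have h := (Algebra.IsEffective.of_faithfullyFlat A (∀ i, B i) y).mp ?_
  · obtain ⟨r, hr⟩ := h
    exact ⟨r, fun i => congrFun hr i⟩
  · change y ⊗ₜ[A] 1 - 1 ⊗ₜ[A] y = 0
    rw [sub_eq_zero]
    apply (TensorProduct.piRight A A (∀ i, B i) B).injective
    funext j
    apply (TensorProduct.piLeft A (B j) B).injective
    funext i
    simpa using hy i j

end descent

instance isPrime_span_p (p : ℕ) [Fact p.Prime] : (Ideal.span {(p : ℤ)}).IsPrime :=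
  (Ideal.span_singleton_prime (by exact_mod_cast (Fact.out : p.Prime).ne_zero)).mpr
    (Nat.prime_iff_prime_int.mp Fact.out)

/-- The ring `ℤ_(p)`: the localization of `ℤ` at the prime ideal `(p)`. -/
abbrev ZLoc (p : ℕ) [Fact p.Prime] : Type := Localization.AtPrime (Ideal.span {(p : ℤ)})


/-- An object of the site of `M_fg` over `ℤ_(p)`: a `p`-local commutative ring `R`
(a `ℤ_(p)`-algebra) with a commutative one-dimensional formal group law over it. It stands for the
affine scheme `Spec R` with the map to `M_fg` given by the formal group of that law.

`M_fg` is the fpqc stack associated to the prestack `R ↦ {formal group laws over R and their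
isomorphisms}`. A sheaf on a stack is the same as a sheaf on a prestack that it is associated to
(every formal group admits a coordinate locally), so the category of these objects, with the fpqc
topology below, is a site for `M_fg`. Rings live in `Type`, sheaves take values in groups in
`Type 1`, so that the site is small with respect to the universe of the coefficients. -/
structure MfgAff (p : ℕ) [Fact p.Prime] where
  ring : Type
  [commRing : CommRing ring]
  [algebra : Algebra (ZLoc p) ring]
  law : FormalGroup ring
  [isComm : law.IsComm]

namespace MfgAff

attribute [instance] commRing algebra isComm

variable {p : ℕ} [Fact p.Prime]

/-- A morphism `(Spec R, F) ⟶ (Spec S, G)` over `M_fg`: a map `φ : Spec R ⟶ Spec S` over `ℤ_(p)`,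
with an isomorphism of formal groups `F ≅ φ^* G` over `R`, given by an invertible power series. -/
@[ext]
structure Hom (X Y : MfgAff p) where
  ringHom : Y.ring →ₐ[ZLoc p] X.ring
  iso : PowerSeries X.ring
  isUnit : IsUnit (PowerSeries.coeff 1 iso)
  isHom : X.law.IsHom (Y.law.map (ringHom : Y.ring →+* X.ring)) iso

lemma hasSubst_iso {X Y : MfgAff p} (f : Hom X Y) : PowerSeries.HasSubst f.iso :=
  PowerSeries.HasSubst.of_constantCoeff_zero' f.isHom.1

def Hom.id (X : MfgAff p) : Hom X X where
  ringHom := AlgHom.id _ _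
  iso := PowerSeries.X
  isUnit := by simp
  isHom := by
    have h : X.law.map ((AlgHom.id (ZLoc p) X.ring : X.ring →ₐ[ZLoc p] X.ring) :
        X.ring →+* X.ring) = X.law := X.law.map_id
    rw [h]
    exact FormalGroup.IsHom.id _

def Hom.comp {X Y Z : MfgAff p} (f : Hom X Y) (g : Hom Y Z) : Hom X Z where
  ringHom := f.ringHom.comp g.ringHom
  iso := PowerSeries.subst f.iso (PowerSeries.map (f.ringHom : Y.ring →+* X.ring) g.iso)
  isUnit := by
    rw [FormalGroup.coeff_one_subst f.isHom.1, PowerSeries.coeff_map]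
    exact f.isUnit.mul (g.isUnit.map _)
  isHom := by
    have h := f.isHom.comp (g.isHom.map (f.ringHom : Y.ring →+* X.ring))
    rwa [FormalGroup.map_map] at h

instance : Category (MfgAff p) where
  Hom := Hom
  id := Hom.id
  comp := Hom.comp
  id_comp {X Y} f := by
    apply Hom.ext
    · exact AlgHom.ext fun _ => rfl
    · change PowerSeries.subst PowerSeries.X (PowerSeries.map (RingHom.id _) f.iso) = f.iso
      rw [PowerSeries.map_id, PowerSeries.X_subst]
      rfl
  comp_id {X Y} f := by
    apply Hom.ext
    · exact AlgHom.ext fun _ => rfl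
    · change PowerSeries.subst f.iso (PowerSeries.map _ PowerSeries.X) = f.iso
      rw [PowerSeries.map_X, PowerSeries.subst_X (hasSubst_iso f)]
  assoc {W X Y Z} f g h := by
    apply Hom.ext
    · exact AlgHom.ext fun _ => rfl
    · change PowerSeries.subst (PowerSeries.subst f.iso (PowerSeries.map _ g.iso))
          (PowerSeries.map ((f.ringHom.comp g.ringHom : Y.ring →ₐ[ZLoc p] W.ring) :
            Y.ring →+* W.ring) h.iso) =
        PowerSeries.subst f.iso (PowerSeries.map (f.ringHom : X.ring →+* W.ring)
          (PowerSeries.subst g.iso (PowerSeries.map (g.ringHom : Y.ring →+* X.ring) h.iso)))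
      have e : PowerSeries.map (f.ringHom : X.ring →+* W.ring) (PowerSeries.subst g.iso
          (PowerSeries.map (g.ringHom : Y.ring →+* X.ring) h.iso)) =
          PowerSeries.subst (PowerSeries.map (f.ringHom : X.ring →+* W.ring) g.iso)
            (PowerSeries.map (f.ringHom : X.ring →+* W.ring)
              (PowerSeries.map (g.ringHom : Y.ring →+* X.ring) h.iso)) :=
        PowerSeries.map_subst (hasSubst_iso g) _
      have e' : PowerSeries.map ((f.ringHom.comp g.ringHom : Y.ring →ₐ[ZLoc p] W.ring) :
            Y.ring →+* W.ring) h.iso = PowerSeries.map (f.ringHom : X.ring →+* W.ring)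
              (PowerSeries.map (g.ringHom : Y.ring →+* X.ring) h.iso) := by
        ext n
        simp [PowerSeries.coeff_map]
      rw [e, e', PowerSeries.subst_comp_subst_apply
        (PowerSeries.HasSubst.of_constantCoeff_zero'
          (FormalGroup.constantCoeff_map_zero _ g.isHom.1)) (hasSubst_iso f)]

/-- The map on rings underlying a morphism. -/
def onRing {X Y : MfgAff p} (f : X ⟶ Y) : Y.ring →ₐ[ZLoc p] X.ring := Hom.ringHom f

/-- For `f = (φ, h) : (Spec R, F) ⟶ (Spec S, G)`, the unit `h'(0)` of `R`: if `x` and `y` are the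
coordinates of `F` and `G`, then `f` pulls the invariant differential at the origin `dy` back to
`h'(0) • dx`. -/
def slope {X Y : MfgAff p} (f : X ⟶ Y) : X.ringˣ := (Hom.isUnit f).unit

@[simp]
lemma onRing_id (X : MfgAff p) (r : X.ring) : onRing (𝟙 X) r = r := rfl

@[simp]
lemma onRing_comp {X Y Z : MfgAff p} (f : X ⟶ Y) (g : Y ⟶ Z) (r : Z.ring) :
    onRing (f ≫ g) r = onRing f (onRing g r) := rfl

@[simp]
lemma slope_id (X : MfgAff p) : slope (𝟙 X) = 1 := by
  ext
  exact PowerSeries.coeff_one_X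

lemma slope_comp {X Y Z : MfgAff p} (f : X ⟶ Y) (g : Y ⟶ Z) :
    slope (f ≫ g) = slope f * Units.map (onRing f : Y.ring →* X.ring) (slope g) := by
  ext
  change PowerSeries.coeff 1 (PowerSeries.subst (Hom.iso f) (PowerSeries.map _ (Hom.iso g))) = _
  rw [FormalGroup.coeff_one_subst (Hom.isHom f).1, PowerSeries.coeff_map]
  rfl

/-- A finite family of morphisms to `X` is an fpqc covering if the underlying maps of affine
schemes are flat and jointly surjective. -/
def IsCovering {X : MfgAff p} {ι : Type} {Y : ι → MfgAff p} (f : ∀ i, Y i ⟶ X) : Prop :=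
  (∀ i, (onRing (f i) : X.ring →+* (Y i).ring).Flat) ∧
    ∀ P : PrimeSpectrum X.ring,
      ∃ i, P ∈ Set.range (PrimeSpectrum.comap (onRing (f i) : X.ring →+* (Y i).ring))

/-- Fibre products over the stack: two morphisms to `X` complete to a square whose ring is the
tensor product of the rings. -/
lemma exists_square {X Y Z : MfgAff p} (f : Y ⟶ X) (g : Z ⟶ X) :
    letI := (onRing f : X.ring →+* Y.ring).toAlgebra
    letI := (onRing g : X.ring →+* Z.ring).toAlgebra
    ∃ (W : MfgAff p) (a : W ⟶ Y) (b : W ⟶ Z) (e : Z.ring ⊗[X.ring] Y.ring ≃+* W.ring),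
      a ≫ f = b ≫ g ∧ (∀ y, onRing a y = e (1 ⊗ₜ y)) ∧ ∀ z, onRing b z = e (z ⊗ₜ 1) := by
  let := (onRing f : X.ring →+* Y.ring).toAlgebra
  let := (onRing g : X.ring →+* Z.ring).toAlgebra
  have : IsScalarTower (ZLoc p) X.ring Y.ring :=
    IsScalarTower.of_algebraMap_eq fun r => ((onRing f).commutes r).symm
  have : IsScalarTower (ZLoc p) X.ring Z.ring :=
    IsScalarTower.of_algebraMap_eq fun r => ((onRing g).commutes r).symm
  let inl : Z.ring →ₐ[ZLoc p] Z.ring ⊗[X.ring] Y.ring := Algebra.TensorProduct.includeLeft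
  let inr : Y.ring →ₐ[ZLoc p] Z.ring ⊗[X.ring] Y.ring :=
    (Algebra.TensorProduct.includeRight : Y.ring →ₐ[X.ring] _).restrictScalars (ZLoc p)
  have hcomm : inr.comp (onRing f) = inl.comp (onRing g) := by
    ext x
    exact (Algebra.TensorProduct.includeRight : Y.ring →ₐ[X.ring] Z.ring ⊗[X.ring] Y.ring).commutes x
  have hcomm' : (inr : Y.ring →+* Z.ring ⊗[X.ring] Y.ring).comp (onRing f : X.ring →+* Y.ring) =
      (inl : Z.ring →+* Z.ring ⊗[X.ring] Y.ring).comp (onRing g : X.ring →+* Z.ring) :=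
    RingHom.ext fun x => DFunLike.congr_fun hcomm x
  let W : MfgAff p :=
    { ring := Z.ring ⊗[X.ring] Y.ring
      law := Z.law.map (inl : Z.ring →+* Z.ring ⊗[X.ring] Y.ring)
      isComm := FormalGroup.isComm_map _ _ }
  let b : W ⟶ Z :=
    { ringHom := inl
      iso := PowerSeries.X
      isUnit := by simp
      isHom := FormalGroup.IsHom.id _ }
  have hf := (Hom.isHom f).map (inr : Y.ring →+* Z.ring ⊗[X.ring] Y.ring)
  have hfu : IsUnit (PowerSeries.coeff 1 (PowerSeries.map (inr : Y.ring →+* Z.ring ⊗[X.ring] Y.ring) (Hom.iso f))) := by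
    rw [PowerSeries.coeff_map]
    exact (Hom.isUnit f).map _
  obtain ⟨k, hk, hku, -, hfk⟩ := hf.inv hfu
  have hg := (Hom.isHom g).map (inl : Z.ring →+* Z.ring ⊗[X.ring] Y.ring)
  rw [FormalGroup.map_map] at hg hk
  have hk' : (X.law.map ((inl : Z.ring →+* Z.ring ⊗[X.ring] Y.ring).comp (onRing g : X.ring →+* Z.ring))).IsHom
      (Y.law.map (inr : Y.ring →+* Z.ring ⊗[X.ring] Y.ring)) k := by
    rw [← hcomm']; exact hk
  let a : W ⟶ Y :=
    { ringHom := inr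
      iso := PowerSeries.subst (PowerSeries.map (inl : Z.ring →+* Z.ring ⊗[X.ring] Y.ring) (Hom.iso g)) k
      isUnit := by
        rw [FormalGroup.coeff_one_subst hg.1]
        refine IsUnit.mul ?_ hku
        rw [PowerSeries.coeff_map]
        exact (Hom.isUnit g).map _
      isHom := hg.comp hk' }
  refine ⟨W, a, b, RingEquiv.refl _, ?_, fun _ => rfl, fun _ => rfl⟩
  apply Hom.ext
  · exact hcomm
  · have hgs : PowerSeries.HasSubst (PowerSeries.map (inl : Z.ring →+* Z.ring ⊗[X.ring] Y.ring) (Hom.iso g)) :=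
      PowerSeries.HasSubst.of_constantCoeff_zero' hg.1
    have hks : PowerSeries.HasSubst k := PowerSeries.HasSubst.of_constantCoeff_zero' hk.1
    change PowerSeries.subst
        (PowerSeries.subst (PowerSeries.map (inl : Z.ring →+* Z.ring ⊗[X.ring] Y.ring) (Hom.iso g)) k)
        (PowerSeries.map (inr : Y.ring →+* Z.ring ⊗[X.ring] Y.ring) (Hom.iso f)) =
      PowerSeries.subst PowerSeries.X (PowerSeries.map (inl : Z.ring →+* Z.ring ⊗[X.ring] Y.ring) (Hom.iso g))
    rw [← PowerSeries.subst_comp_subst_apply hks hgs, hfk, PowerSeries.subst_X hgs,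
      PowerSeries.X_subst]

lemma IsCovering.exists_pullback {X Z : MfgAff p} {ι : Type} [Finite ι] {Y : ι → MfgAff p}
    {f : ∀ i, Y i ⟶ X} (hf : IsCovering f) (g : Z ⟶ X) :
    ∃ (W : ι → MfgAff p) (b : ∀ i, W i ⟶ Z) (a : ∀ i, W i ⟶ Y i),
      IsCovering b ∧ ∀ i, a i ≫ f i = b i ≫ g := by
  let := (onRing g : X.ring →+* Z.ring).toAlgebra
  let (i : ι) : Algebra X.ring (Y i).ring := (onRing (f i) : X.ring →+* (Y i).ring).toAlgebra
  choose W a b e hab _ hb using fun i => exists_square (f i) g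
  have hb' : ∀ i, (onRing (b i) : Z.ring →+* (W i).ring) =
      ((e i : Z.ring ⊗[X.ring] (Y i).ring →+* (W i).ring)).comp
        (algebraMap Z.ring (Z.ring ⊗[X.ring] (Y i).ring)) :=
    fun i => RingHom.ext fun z => hb i z
  refine ⟨W, b, a, ⟨fun i => ?_, fun P => ?_⟩, hab⟩
  · rw [hb' i]
    have : Module.Flat X.ring (Y i).ring := hf.1 i
    refine RingHom.Flat.comp ?_ (RingHom.Flat.of_bijective (e i).bijective)
    rw [RingHom.flat_algebraMap_iff]
    infer_instance
  · obtain ⟨i, Q, hQ⟩ := exists_mem_range_comap_baseChange hf.1 hf.2 P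
    refine ⟨i, PrimeSpectrum.comap ((e i).symm : (W i).ring →+* Z.ring ⊗[X.ring] (Y i).ring) Q, ?_⟩
    rw [hb' i, ← PrimeSpectrum.comap_comp_apply, ← RingHom.comp_assoc]
    have : ((e i).symm : (W i).ring →+* Z.ring ⊗[X.ring] (Y i).ring).comp
      (e i : Z.ring ⊗[X.ring] (Y i).ring →+* (W i).ring) = RingHom.id _ :=
      RingHom.ext fun x => (e i).symm_apply_apply x
    rw [this, RingHom.id_comp, hQ]

/-- The fpqc topology on the site of `M_fg`: a sieve is covering if it contains a finite family
of morphisms whose underlying maps of affine schemes are flat and jointly surjective. -/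
def fpqc (p : ℕ) [Fact p.Prime] : GrothendieckTopology (MfgAff p) where
  sieves X := {S | ∃ (ι : Type) (_ : Finite ι) (Y : ι → MfgAff p) (f : ∀ i, Y i ⟶ X),
    IsCovering f ∧ ∀ i, S (f i)}
  top_mem' X := by
    refine ⟨Unit, inferInstance, fun _ => X, fun _ => 𝟙 X, ⟨fun _ => RingHom.Flat.id _,
      fun P => ⟨(), P, rfl⟩⟩, fun _ => trivial⟩
  pullback_stable' X Z S g := by
    rintro ⟨ι, _, Y, f, hf, hS⟩
    obtain ⟨W, b, a, hb, hab⟩ := hf.exists_pullback g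
    refine ⟨ι, inferInstance, W, b, hb, fun i => ?_⟩
    change S (b i ≫ g)
    rw [← hab i]
    exact S.downward_closed (hS i) _
  transitive' X S := by
    rintro ⟨ι, _, Y, f, hf, hS⟩ R hR
    choose κ hκ Z g hg hgR using fun i => hR (hS i)
    refine ⟨Σ i, κ i, inferInstance, fun x => Z x.1 x.2, fun x => g x.1 x.2 ≫ f x.1,
      ⟨fun x => ?_, fun P => ?_⟩, fun x => hgR x.1 x.2⟩
    · exact RingHom.Flat.comp (hf.1 x.1) ((hg x.1).1 x.2)
    · obtain ⟨i, Q, rfl⟩ := hf.2 P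
      obtain ⟨j, Q', rfl⟩ := (hg i).2 Q
      exact ⟨⟨i, j⟩, Q', rfl⟩

/-- Restriction of sections of `ω^{⊗ u}` along `f`: the section `r • (dy)^{⊗ u}` is sent to
`φ(r) h'(0)^u • (dx)^{⊗ u}`. -/
def restrict (u : ℤ) {X Y : MfgAff p} (f : X ⟶ Y) : Y.ring →ₗ[ZLoc p] X.ring :=
  LinearMap.mulLeft (ZLoc p) ((slope f ^ u : X.ringˣ) : X.ring) ∘ₗ (onRing f).toLinearMap

lemma restrict_apply (u : ℤ) {X Y : MfgAff p} (f : X ⟶ Y) (r : Y.ring) :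
    restrict u f r = ((slope f ^ u : X.ringˣ) : X.ring) * onRing f r := rfl

lemma restrict_id (u : ℤ) (X : MfgAff p) (r : X.ring) : restrict u (𝟙 X) r = r := by
  simp [restrict_apply]

lemma restrict_comp (u : ℤ) {X Y Z : MfgAff p} (f : X ⟶ Y) (g : Y ⟶ Z) (r : Z.ring) :
    restrict u (f ≫ g) r = restrict u f (restrict u g r) := by
  simp only [restrict_apply, slope_comp, mul_zpow, ← map_zpow, map_mul, onRing_comp, Units.val_mul,
    mul_assoc]
  rfl

/-- The presheaf `ω^{⊗ u}` on the site of `M_fg`, where `ω` is the dual of the Lie algebra.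
On `(Spec R, F)` the line bundle `ω` is free on `dx`, for `x` the coordinate of `F`, and
`r : R` stands for the section `r • (dx)^{⊗ u}`. -/
def omegaPresheaf (p : ℕ) [Fact p.Prime] (u : ℤ) : (MfgAff p)ᵒᵖ ⥤ AddCommGrpCat.{1} where
  obj X := AddCommGrpCat.of (ULift.{1} X.unop.ring)
  map {X Y} f := AddCommGrpCat.ofHom
    { toFun := fun r => ULift.up (restrict u f.unop r.down)
      map_zero' := ULift.ext _ _ (map_zero _)
      map_add' := fun _ _ => ULift.ext _ _ (map_add _ _ _) }
  map_id X := by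
    ext r
    exact (restrict_id u X.unop r.down)
  map_comp f g := by
    ext r
    exact (restrict_comp u g.unop f.unop r.down)

lemma IsCovering.ext {X : MfgAff p} {ι : Type} [Finite ι] {Y : ι → MfgAff p}
    {f : ∀ i, Y i ⟶ X} (hf : IsCovering f) (u : ℤ) {r s : X.ring}
    (h : ∀ i, restrict u (f i) r = restrict u (f i) s) : r = s := by
  let (i : ι) : Algebra X.ring (Y i).ring := (onRing (f i) : X.ring →+* (Y i).ring).toAlgebra
  refine algebraMap_pi_injective hf.1 hf.2 fun i => ?_
  exact (Units.mul_right_inj _).mp (h i)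

/-- Faithfully flat descent for sections of `ω^{⊗ u}`. -/
lemma IsCovering.exists_glue {X : MfgAff p} {ι : Type} [Finite ι] {Y : ι → MfgAff p}
    {f : ∀ i, Y i ⟶ X} (hf : IsCovering f) (u : ℤ) (x : ∀ i, (Y i).ring)
    (hx : ∀ i j (W : MfgAff p) (a : W ⟶ Y i) (b : W ⟶ Y j), a ≫ f i = b ≫ f j →
      restrict u a (x i) = restrict u b (x j)) :
    ∃ r : X.ring, ∀ i, restrict u (f i) r = x i := by
  let (i : ι) : Algebra X.ring (Y i).ring := (onRing (f i) : X.ring →+* (Y i).ring).toAlgebra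
  have hy : ∀ i j, ((((slope (f i))⁻¹ ^ u : (Y i).ringˣ) : (Y i).ring) * x i) ⊗ₜ[X.ring]
      (1 : (Y j).ring) =
        (1 : (Y i).ring) ⊗ₜ[X.ring] ((((slope (f j))⁻¹ ^ u : (Y j).ringˣ) : (Y j).ring) * x j) := by
    intro i j
    obtain ⟨W, a, b, e, hab, ha, hb⟩ := exists_square (f j) (f i)
    apply e.injective
    rw [← ha, ← hb]
    have h1 := hx i j W b a hab.symm
    have h2 : slope (b ≫ f i) = slope (a ≫ f j) := by rw [hab]
    rw [slope_comp, slope_comp] at h2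
    have key : ∀ {V : MfgAff p} (c : W ⟶ V) (g : V ⟶ X) (y : V.ring),
        onRing c ((((slope g)⁻¹ ^ u : V.ringˣ) : V.ring) * y) =
          ((((slope c * Units.map (onRing c : V.ring →* W.ring) (slope g))⁻¹ ^ u : W.ringˣ)) :
            W.ring) * restrict u c y := by
      intro V c g y
      rw [restrict_apply, map_mul, ← mul_assoc, ← Units.val_mul, ← mul_zpow, mul_inv_rev,
        inv_mul_cancel_right, ← map_inv, ← map_zpow]
      rfl
    rw [key b (f i), key a (f j), h1, h2]
  obtain ⟨r, hr⟩ := exists_algebraMap_eq hf.1 hf.2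
    (fun i => (((slope (f i))⁻¹ ^ u : (Y i).ringˣ) : (Y i).ring) * x i) hy
  refine ⟨r, fun i => ?_⟩
  rw [restrict_apply]
  change _ * algebraMap X.ring (Y i).ring r = x i
  rw [hr i, ← mul_assoc, ← Units.val_mul, ← mul_zpow, mul_inv_cancel, one_zpow, Units.val_one,
    one_mul]

lemma isSheaf_omegaPresheaf (u : ℤ) : Presheaf.IsSheaf (fpqc p) (omegaPresheaf p u) := by
  rw [Presheaf.isSheaf_iff_isSheaf_forget (fpqc p) (omegaPresheaf p u) (forget AddCommGrpCat.{1}),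
    isSheaf_iff_isSheaf_of_type]
  rintro X S ⟨ι, _, Y, f, hf, hS⟩ x hx
  obtain ⟨r, hr⟩ := hf.exists_glue u (fun i => (x (f i) (hS i)).down) (fun i j W a b hab =>
    congrArg ULift.down (hx a b (hS i) (hS j) hab))
  refine ⟨ULift.up r, fun Z g hg => ?_, fun t ht => ?_⟩
  · obtain ⟨W, b, a, hb, hab⟩ := hf.exists_pullback g
    refine ULift.ext _ _ (hb.ext u fun i => ?_)
    change restrict u (b i) (restrict u g r) = restrict u (b i) (x g hg).down
    rw [← restrict_comp, ← hab i, restrict_comp, hr i]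
    exact congrArg ULift.down (hx (a i) (b i) (hS i) hg (hab i))
  · refine ULift.ext _ _ (hf.ext u fun i => ?_)
    change _ = restrict u (f i) r
    rw [hr i]
    exact congrArg ULift.down (ht (f i) (hS i))

/-- The sheaf `ω^{⊗ u}` on `M_fg`. -/
def omega (p : ℕ) [Fact p.Prime] (u : ℤ) : Sheaf (fpqc p) AddCommGrpCat.{1} :=
  ⟨omegaPresheaf p u, isSheaf_omegaPresheaf u⟩

/-- Multiplication by a scalar of `ℤ_(p)` on `ω^{⊗ u}`. -/
def omegaSMul (p : ℕ) [Fact p.Prime] (u : ℤ) (a : ZLoc p) : omega p u ⟶ omega p u :=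
  ⟨{ app := fun X => AddCommGrpCat.ofHom
      { toFun := fun r => ULift.up (a • r.down)
        map_zero' := ULift.ext _ _ (smul_zero _)
        map_add' := fun _ _ => ULift.ext _ _ (smul_add _ _ _) }
     naturality := fun X Y f => by
      ext r
      exact ULift.ext _ _ ((restrict u f.unop).map_smul a r.down).symm }⟩

lemma omega_hom_ext {u : ℤ} {f g : omega p u ⟶ omega p u}
    (h : ∀ (X : (MfgAff p)ᵒᵖ) (r : ULift.{1} X.unop.ring), f.hom.app X r = g.hom.app X r) :
    f = g := by
  apply Sheaf.hom_ext
  ext X r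
  exact h X r

lemma omegaSMul_one (u : ℤ) : omegaSMul p u 1 = 𝟙 _ :=
  omega_hom_ext fun _ r => congrArg ULift.up (one_smul (ZLoc p) r.down)

lemma omegaSMul_mul (u : ℤ) (a b : ZLoc p) :
    omegaSMul p u (a * b) = omegaSMul p u b ≫ omegaSMul p u a :=
  omega_hom_ext fun _ r => congrArg ULift.up (mul_smul a b r.down)

lemma omegaSMul_add (u : ℤ) (a b : ZLoc p) :
    omegaSMul p u (a + b) = omegaSMul p u a + omegaSMul p u b :=
  omega_hom_ext fun _ r => congrArg ULift.up (add_smul a b r.down)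

instance : HasExt.{2} (Sheaf (fpqc p) AddCommGrpCat.{1}) := HasExt.standard _

end MfgAff

/-- The Adams-Novikov `E_2`-term `E_2^{s, 2u} = H^s(M_fg; ω^{⊗ u})` at the prime `p`: the sheaf
cohomology of `ω^{⊗ u}` on the fpqc site of `M_fg`. -/
def AdamsNovikovE2 (p : ℕ) [Fact p.Prime] (s : ℕ) (u : ℤ) : Type 2 :=
  (MfgAff.omega p u).H s

namespace AdamsNovikovE2

variable (p : ℕ) [Fact p.Prime] (s : ℕ) (u : ℤ)

instance : AddCommGroup (AdamsNovikovE2 p s u) :=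
  inferInstanceAs (AddCommGroup ((MfgAff.omega p u).H s))

/-- `ℤ_(p)` acts on cohomology through its action on the coefficients. -/
instance : Module (ZLoc p) (AdamsNovikovE2 p s u) where
  smul a x := Sheaf.H.map (MfgAff.omegaSMul p u a) s x
  one_smul x := by
    change Sheaf.H.map (MfgAff.omegaSMul p u 1) s x = x
    rw [MfgAff.omegaSMul_one]
    exact Sheaf.H.map_id_apply x
  mul_smul a b x := by
    change Sheaf.H.map (MfgAff.omegaSMul p u (a * b)) s x = _
    rw [MfgAff.omegaSMul_mul]
    exact Sheaf.H.map_comp_apply _ _ x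
  smul_zero a := map_zero (Sheaf.H.map (MfgAff.omegaSMul p u a) s)
  smul_add a := map_add (Sheaf.H.map (MfgAff.omegaSMul p u a) s)
  add_smul a b x := by
    change Sheaf.H.map (MfgAff.omegaSMul p u (a + b)) s x = _
    rw [MfgAff.omegaSMul_add]
    exact Sheaf.H.map_add_apply _ _ x
  zero_smul x := by
    change Sheaf.H.map (MfgAff.omegaSMul p u 0) s x = 0
    have h := Sheaf.H.map_add_apply (MfgAff.omegaSMul p u 0) (MfgAff.omegaSMul p u 0) x
    rw [← MfgAff.omegaSMul_add, add_zero] at h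
    exact left_eq_add.mp h

end AdamsNovikovE2

/-- The `p`-torsion exponent of an abelian group: the least `k` with `p ^ k • M = 0`
(and `⊤` if there is none). -/
def torsionExponent (p : ℕ) (M : Type*) [AddCommGroup M] : ℕ∞ :=
  ⨅ (k : ℕ) (_ : ∀ x : M, p ^ k • x = 0), (k : ℕ∞)

end

/-! A natural number n prime to p is a unit in every p-local ring, so multiplication by n is an
automorphism of every formal group over such a ring, and it commutes with all isomorphisms and base
changes. It is thus a natural endomorphism θ of the identity of the site, and its effect on
H^s(ω^{⊗u}) can be computed in two ways.

On coefficients, restriction along θ is multiplication by n^u, because [n](x) = nx + ⋯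
(`endoOfSite_multiplication`). But restriction along θ is also a natural endomorphism of the
identity functor of sheaves, hence central for composition of Ext classes (`ext_comp_natTrans_app`).
Since H^s is Ext^s out of the constant sheaf ℤ, the action can be moved to that sheaf, where it is
trivial (`Sheaf.H_map_endoOfSite`). Therefore n^u acts as 1.

The rest is arithmetic. The torsion exponent is at most v_p(n^|u| - 1) for every n prime to p, and a
good n gives each bound: 3 or 5 for p = 2, a primitive root or 1 + p for p odd. For u ≠ 0 some power
of p therefore kills the group, so a general unit ℓ of ℤ_(p) may be replaced by a natural number
p-adically close to it. -/

noncomputable section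

/-! ### Centrality of natural endomorphisms of the identity for Ext. -/

section center

open Abelian Limits

universe w v u

/-- Natural endomorphisms of the identity functor of an abelian category are central for the
composition of `Ext`-classes. -/
lemma ext_comp_natTrans_app {C : Type u} [Category.{v} C] [Abelian C] [HasExt.{w} C]
    [EnoughInjectives C] (η : 𝟭 C ⟶ 𝟭 C) {X Y : C} {n : ℕ} (x : Ext X Y n) :
    x.comp (Ext.mk₀ (η.app Y)) (add_zero n) = (Ext.mk₀ (η.app X)).comp x (zero_add n) := by
  induction n generalizing Y with
  | zero =>
    obtain ⟨f, rfl⟩ := (Ext.mk₀_bijective X Y).2 x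
    rw [Ext.mk₀_comp_mk₀, Ext.mk₀_comp_mk₀]
    exact congrArg _ (η.naturality f)
  | succ n ih =>
    -- Dimension shifting: Y embeds in an injective I and Ext^{n+1}(X, I) = 0, so x is a class of
    -- degree n with values in I/Y, composed with the extension class of S.
    let S : ShortComplex C := ShortComplex.mk (Injective.ι Y) (cokernel.π (Injective.ι Y)) (by simp)
    have hS : S.ShortExact :=
      { exact := ShortComplex.exact_of_g_is_cokernel _ (cokernelIsCokernel _) }
    obtain ⟨y, rfl⟩ := Ext.covariant_sequence_exact₁ X hS x
      (@Ext.eq_zero_of_injective _ _ _ _ _ _ _ (inferInstanceAs (Injective (Injective.under Y))) _) rfl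
    -- Naturality makes η an endomorphism of the whole sequence, so the extension class commutes
    -- with η.
    let φ : S ⟶ S :=
      { τ₁ := η.app S.X₁
        τ₂ := η.app S.X₂
        τ₃ := η.app S.X₃
        comm₁₂ := (η.naturality S.f).symm
        comm₂₃ := (η.naturality S.g).symm }
    have h : hS.extClass.comp (Ext.mk₀ (η.app Y)) (add_zero 1) =
        (Ext.mk₀ (η.app S.X₃)).comp hS.extClass (zero_add 1) := hS.extClass_naturality hS φ
    rw [Ext.comp_assoc _ _ _ rfl (add_zero 1) (by omega), h,
      ← Ext.comp_assoc _ _ _ (add_zero n) (zero_add 1) (by omega), ih,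
      Ext.comp_assoc _ _ _ (zero_add n) rfl (by omega)]

end center

/-! ### Endomorphisms of the identity of a site, acting on sheaf cohomology. -/

section siteEndomorphism

universe w w' v u v' u'

variable {C : Type u} [Category.{v} C] {J : GrothendieckTopology C}
  {A : Type u'} [Category.{v'} A]

/-- A natural endomorphism of the identity of a site acts on every sheaf by restriction. -/
def Sheaf.endoOfSite (J : GrothendieckTopology C) (A : Type u') [Category.{v'} A]
    (θ : 𝟭 C ⟶ 𝟭 C) : 𝟭 (Sheaf J A) ⟶ 𝟭 (Sheaf J A) where
  app F :=
    ⟨{ app := fun X => F.obj.map (θ.app X.unop).op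
       naturality := fun X Y f => by
        change F.obj.map f ≫ F.obj.map (θ.app Y.unop).op =
          F.obj.map (θ.app X.unop).op ≫ F.obj.map f
        rw [← Functor.map_comp, ← Functor.map_comp]
        congr 1
        exact Quiver.Hom.unop_inj (θ.naturality f.unop).symm }⟩
  naturality F G f := by
    apply Sheaf.hom_ext
    ext X
    exact (f.hom.naturality (θ.app X.unop).op).symm

/-- All restriction maps of a constant presheaf are identities, and a map from its sheafification to
a sheaf is determined on the presheaf. -/
lemma Sheaf.endoOfSite_constantSheaf [HasWeakSheafify J A] (θ : 𝟭 C ⟶ 𝟭 C) (M : A) :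
    (Sheaf.endoOfSite J A θ).app ((constantSheaf J A).obj M) = 𝟙 _ := by
  apply Sheaf.hom_ext
  apply sheafify_hom_ext J (P := (Functor.const Cᵒᵖ).obj M)
    _ _ ((constantSheaf J A).obj M).property
  ext X
  have h := (toSheafify J ((Functor.const Cᵒᵖ).obj M)).naturality (θ.app X.unop).op
  exact h.symm.trans ((Category.id_comp _).trans (Category.comp_id _).symm)

/-- The action on a sheaf of a natural endomorphism of the identity of the site induces the
identity on cohomology. -/
lemma Sheaf.H_map_endoOfSite {J : GrothendieckTopology C} [HasSheafify J AddCommGrpCat.{w}]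
    [CategoryTheory.HasExt.{w'} (Sheaf J AddCommGrpCat.{w})]
    [EnoughInjectives (Sheaf J AddCommGrpCat.{w})] (θ : 𝟭 C ⟶ 𝟭 C)
    (F : Sheaf J AddCommGrpCat.{w}) {n : ℕ} (x : F.H n) :
    Sheaf.H.map ((Sheaf.endoOfSite J AddCommGrpCat.{w} θ).app F) n x = x := by
  -- A cohomology class is an Ext class out of the constant sheaf ℤ; centrality moves the action
  -- from F to that source.
  rw [Sheaf.H.map_apply]
  refine (ext_comp_natTrans_app (Sheaf.endoOfSite J AddCommGrpCat.{w} θ) x).trans ?_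
  rw [Sheaf.endoOfSite_constantSheaf]
  exact Abelian.Ext.mk₀_id_comp x

end siteEndomorphism

/-! ### Enough injectives on the site of formal groups. -/

namespace MfgAff

/-- Dimension shifting needs injectives. The rings live in `Type`, so the site is small relative to
coefficients in `Type 1`, and its abelian sheaves form a Grothendieck abelian category. -/
instance enoughInjectives_sheaf (p : ℕ) [Fact p.Prime] :
    EnoughInjectives (Sheaf (fpqc p) AddCommGrpCat.{1}) := by
  have : EssentiallySmall.{1} (MfgAff p) := inferInstance
  have := Sheaf.isGrothendieckAbelian_of_essentiallySmall (fpqc p) AddCommGrpCat.{1}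
  exact IsGrothendieckAbelian.enoughInjectives

end MfgAff

/-! ### Points of a formal group law and the series [n]. -/

namespace FormalGroup

section

variable {R S : Type} [CommRing R] [CommRing S]

lemma Point.hasSubst_pair {σ : Type} {F : FormalGroup R} (x y : F.Point σ) :
    MvPowerSeries.HasSubst ![x.val, y.val] :=
  MvPowerSeries.hasSubst_of_constantCoeff_nilpotent fun i => by
    fin_cases i
    · exact x.prop
    · exact y.prop

/-- A homomorphism of formal group laws induces a homomorphism on points. -/
def IsHom.pointMap {F G : FormalGroup R} {f : PowerSeries R} (hf : IsHom F G f) (σ : Type) :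
    F.Point σ →+ G.Point σ where
  toFun x := ⟨PowerSeries.subst x.val f,
    MvPowerSeries.IsNilpotent_subst x.prop.const (by
      have : MvPowerSeries.constantCoeff f = 0 := hf.1
      rw [this]
      exact IsNilpotent.zero)⟩
  map_zero' := Subtype.ext (MvPowerSeries.subst_zero_of_constantCoeff_zero hf.1)
  map_add' x y := by
    apply Subtype.ext
    have hxy := Point.hasSubst_pair x y
    have h := congrArg (MvPowerSeries.subst ![x.val, y.val]) hf.2
    rw [subst_subst_one F.hasSubst_law hxy, subst_subst_pair (FormalGroup.hasSubst_pair hf.1) hxy,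
      subst_subst_one (PowerSeries.HasSubst.X _) hxy,
      subst_subst_one (PowerSeries.HasSubst.X _) hxy,
      MvPowerSeries.subst_X hxy, MvPowerSeries.subst_X hxy] at h
    exact h

/-- Substitution of power series is a homomorphism on points. -/
def Point.substHom (F : FormalGroup R) {σ τ : Type} {b : σ → MvPowerSeries τ R}
    (hb : MvPowerSeries.HasSubst b) : F.Point σ →+ F.Point τ where
  toFun x := ⟨MvPowerSeries.subst b x.val, MvPowerSeries.IsNilpotent_subst hb x.prop⟩
  map_zero' := by
    apply Subtype.ext
    change MvPowerSeries.subst b (0 : MvPowerSeries σ R) = 0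
    rw [← MvPowerSeries.coe_substAlgHom hb, map_zero]
  map_add' x y := by
    apply Subtype.ext
    change MvPowerSeries.subst b (MvPowerSeries.subst ![x.val, y.val] F.toPowerSeries) =
      MvPowerSeries.subst ![MvPowerSeries.subst b x.val, MvPowerSeries.subst b y.val]
        F.toPowerSeries
    exact subst_subst_pair (Point.hasSubst_pair x y) hb _

/-- Base change is a homomorphism on points. -/
def Point.mapHom (F : FormalGroup R) (φ : R →+* S) (σ : Type) :
    F.Point σ →+ (F.map φ).Point σ where
  toFun x := ⟨MvPowerSeries.map φ x.val, by
    have h := IsNilpotent.map x.prop φ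
    rwa [← MvPowerSeries.constantCoeff_map] at h⟩
  map_zero' := Subtype.ext (map_zero _)
  map_add' x y := by
    apply Subtype.ext
    change MvPowerSeries.map φ (MvPowerSeries.subst ![x.val, y.val] F.toPowerSeries) =
      MvPowerSeries.subst ![MvPowerSeries.map φ x.val, MvPowerSeries.map φ y.val]
        (MvPowerSeries.map φ F.toPowerSeries)
    rw [MvPowerSeries.map_subst (hasSubst_pair x y)]
    congr 1
    ext1 i
    fin_cases i <;> rfl

/-- The coordinate of a formal group law as a point. -/
def Point.coordinate (F : FormalGroup R) : F.Point Unit :=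
  ⟨PowerSeries.X, PowerSeries.HasSubst.X'⟩

/-- The `n`-series `[n](x)` of a formal group law. -/
def nSeries (F : FormalGroup R) (n : ℕ) : PowerSeries R := (n • Point.coordinate F).val

/-- The coordinate is the universal point: x is its image under substitution, a group homomorphism,
which commutes with multiplication by n. -/
lemma subst_nSeries (F : FormalGroup R) {σ : Type} (x : F.Point σ) (n : ℕ) :
    PowerSeries.subst x.val (F.nSeries n) = (n • x).val := by
  have h := map_nsmul (Point.substHom F x.prop.const) n (Point.coordinate F)
  have hx : Point.substHom F x.prop.const (Point.coordinate F) = x :=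
    Subtype.ext (PowerSeries.subst_X x.prop)
  rw [hx] at h
  exact congrArg Subtype.val h

lemma map_nSeries (F : FormalGroup R) (φ : R →+* S) (n : ℕ) :
    PowerSeries.map φ (F.nSeries n) = (F.map φ).nSeries n := by
  have h := map_nsmul (Point.mapHom F φ Unit) n (Point.coordinate F)
  have hx : Point.mapHom F φ Unit (Point.coordinate F) = Point.coordinate (F.map φ) :=
    Subtype.ext (PowerSeries.map_X φ)
  rw [hx] at h
  exact congrArg Subtype.val h

lemma constantCoeff_nSeries (F : FormalGroup R) (n : ℕ) :
    PowerSeries.constantCoeff (F.nSeries n) = 0 := by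
  induction n with
  | zero => exact map_zero _
  | succ n ih =>
    have h : F.nSeries (n + 1) =
        MvPowerSeries.subst ![F.nSeries n, PowerSeries.X] F.toPowerSeries :=
      congrArg Subtype.val (succ_nsmul (Point.coordinate F) n)
    rw [h]
    refine MvPowerSeries.constantCoeff_subst_eq_zero
      (Point.hasSubst_pair (n • Point.coordinate F) (Point.coordinate F)) (fun i => ?_)
      F.zero_constantCoeff
    fin_cases i
    · exact ih
    · exact PowerSeries.constantCoeff_X

/-- A formal group law is X + Y modulo terms of degree at least 2. -/
lemma coeff_one_subst_pair (F : FormalGroup R) {f g : PowerSeries R}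
    (hf : PowerSeries.constantCoeff f = 0) (hg : PowerSeries.constantCoeff g = 0) :
    PowerSeries.coeff 1 (MvPowerSeries.subst ![f, g] F.toPowerSeries : PowerSeries R) =
      PowerSeries.coeff 1 f + PowerSeries.coeff 1 g := by
  classical
  have hs : MvPowerSeries.HasSubst ![f, g] :=
    MvPowerSeries.hasSubst_of_constantCoeff_zero fun i => by
      fin_cases i
      · exact hf
      · exact hg
  rw [PowerSeries.coeff, MvPowerSeries.coeff_subst hs,
    finsum_eq_sum_of_support_subset (s := {Finsupp.single 0 1, Finsupp.single 1 1}),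
    Finset.sum_pair]
  · simp [F.lin_coeff_X, F.lin_coeff_Y]
  · simp [Finsupp.single_left_inj]
  · intro d hd
    by_contra hd'
    apply hd
    beta_reduce
    simp only [Finset.coe_insert, Finset.coe_singleton, Set.mem_insert_iff,
      Set.mem_singleton_iff, not_or, Finsupp.ext_iff, Fin.forall_fin_two] at hd'
    simp at hd'
    -- The remaining exponents have total degree 0, where the law has zero coefficient, or at least
    -- 2, where the monomial in f and g has no linear term.
    have hdvd : (PowerSeries.X : PowerSeries R) ^ (d 0 + d 1) ∣ f ^ d 0 * g ^ d 1 := by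
      rw [pow_add]
      exact mul_dvd_mul (pow_dvd_pow_of_dvd (PowerSeries.X_dvd_iff.mpr hf) _)
        (pow_dvd_pow_of_dvd (PowerSeries.X_dvd_iff.mpr hg) _)
    by_cases h0 : d 0 + d 1 = 0
    · have h1 : d = 0 := by ext i; fin_cases i <;> simp <;> omega
      rw [h1, MvPowerSeries.coeff_zero_eq_constantCoeff_apply, F.zero_constantCoeff, zero_smul]
    · have h2 : PowerSeries.coeff 1 (f ^ d 0 * g ^ d 1) = 0 :=
        PowerSeries.X_pow_dvd_iff.mp hdvd 1 (by omega)
      have h3 : (d.prod fun s e => ![f, g] s ^ e) = f ^ d 0 * g ^ d 1 := by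
        rw [Finsupp.prod_fintype _ _ (by simp)]
        simp
      rw [h3]
      exact (congrArg _ h2).trans (smul_zero _)

lemma coeff_one_nSeries (F : FormalGroup R) (n : ℕ) : PowerSeries.coeff 1 (F.nSeries n) = n := by
  induction n with
  | zero => exact (map_zero _).trans Nat.cast_zero.symm
  | succ n ih =>
    have h : F.nSeries (n + 1) =
        MvPowerSeries.subst ![F.nSeries n, PowerSeries.X] F.toPowerSeries :=
      congrArg Subtype.val (succ_nsmul (Point.coordinate F) n)
    rw [h, F.coeff_one_subst_pair (F.constantCoeff_nSeries n) PowerSeries.constantCoeff_X, ih,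
      PowerSeries.coeff_one_X, Nat.cast_succ]

/-- In the commutative group of points in two variables, n(x + y) = nx + ny, applied to the two
coordinate points, whose sum is the law itself. -/
lemma isHom_nSeries (F : FormalGroup R) [F.IsComm] (n : ℕ) : IsHom F F (F.nSeries n) := by
  refine ⟨F.constantCoeff_nSeries n, ?_⟩
  let x : F.Point (Fin 2) := ⟨MvPowerSeries.X 0, PowerSeries.HasSubst.X _⟩
  let y : F.Point (Fin 2) := ⟨MvPowerSeries.X 1, PowerSeries.HasSubst.X _⟩
  have hxy : (x + y).val = F.toPowerSeries := subst_X_pair _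
  have h := F.subst_nSeries (x + y) n
  rw [nsmul_add, hxy] at h
  rw [h, add_apply, ← subst_nSeries, ← subst_nSeries]

/-- A homomorphism of laws is additive on points, so it commutes with multiplication by n; evaluate
at the coordinate. -/
lemma IsHom.subst_nSeries {F G : FormalGroup R} {f : PowerSeries R} (hf : IsHom F G f) (n : ℕ) :
    PowerSeries.subst (F.nSeries n) f = PowerSeries.subst f (G.nSeries n) := by
  have h := map_nsmul (hf.pointMap Unit) n (Point.coordinate F)
  have hx : hf.pointMap Unit (Point.coordinate F) =
      ⟨f, PowerSeries.HasSubst.of_constantCoeff_zero' hf.1⟩ :=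
    Subtype.ext (PowerSeries.X_subst f)
  rw [hx] at h
  exact (congrArg Subtype.val h).trans (G.subst_nSeries _ n).symm

end

end FormalGroup

/-! ### Multiplication by n as an endomorphism of the site. -/

namespace MfgAff

variable {p : ℕ} [Fact p.Prime]

/-- Multiplication by a natural number `n` invertible in `ℤ_(p)`, as an endomorphism of a formal
group. -/
def mulEndo {n : ℕ} (hn : IsUnit (n : ZLoc p)) (X : MfgAff p) : Hom X X where
  ringHom := AlgHom.id _ _
  iso := X.law.nSeries n
  isUnit := by
    rw [FormalGroup.coeff_one_nSeries]
    simpa using hn.map (algebraMap (ZLoc p) X.ring)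
  isHom := by
    have h : X.law.map ((AlgHom.id (ZLoc p) X.ring : X.ring →ₐ[ZLoc p] X.ring) :
        X.ring →+* X.ring) = X.law := X.law.map_id
    rw [h]
    exact X.law.isHom_nSeries n

/-- This is naturality of [n]: it is compatible with base change and with homomorphisms of formal
group laws. -/
lemma comp_mulEndo {n : ℕ} (hn : IsUnit (n : ZLoc p)) {X Y : MfgAff p} (f : Hom X Y) :
    f.comp (mulEndo hn Y) = (mulEndo hn X).comp f := by
  apply Hom.ext
  · exact AlgHom.ext fun _ => rfl
  · change PowerSeries.subst f.iso (PowerSeries.map _ (Y.law.nSeries n)) =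
      PowerSeries.subst (X.law.nSeries n) (PowerSeries.map (RingHom.id _) f.iso)
    rw [FormalGroup.map_nSeries, ← f.isHom.subst_nSeries, PowerSeries.map_id]
    rfl

/-- Multiplication by a natural number `n` invertible in `ℤ_(p)`, as a natural endomorphism of the
identity of the site of `M_fg`. -/
def multiplication {n : ℕ} (hn : IsUnit (n : ZLoc p)) : 𝟭 (MfgAff p) ⟶ 𝟭 (MfgAff p) where
  app X := mulEndo hn X
  naturality _ _ f := comp_mulEndo hn f

lemma slope_multiplication {n : ℕ} (hn : IsUnit (n : ZLoc p)) (X : MfgAff p) :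
    slope ((multiplication hn).app X) =
      Units.map (algebraMap (ZLoc p) X.ring : ZLoc p →* X.ring) hn.unit := by
  ext
  change PowerSeries.coeff 1 (X.law.nSeries n) = algebraMap (ZLoc p) X.ring n
  rw [FormalGroup.coeff_one_nSeries, map_natCast]

/-- The ring map underlying [n] is the identity, so only the twist by the u-th power of the slope
[n]'(0) = n remains. -/
lemma endoOfSite_multiplication {n : ℕ} (hn : IsUnit (n : ZLoc p)) (u : ℤ) :
    (Sheaf.endoOfSite (fpqc p) AddCommGrpCat.{1} (multiplication hn)).app (omega p u) =
      omegaSMul p u ((hn.unit ^ u : (ZLoc p)ˣ) : ZLoc p) := by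
  refine omega_hom_ext fun X r => ULift.ext _ _ ?_
  change restrict u ((multiplication hn).app X.unop) r.down =
    ((hn.unit ^ u : (ZLoc p)ˣ) : ZLoc p) • r.down
  rw [restrict_apply, slope_multiplication, ← map_zpow, Algebra.smul_def]
  rfl

end MfgAff

namespace AdamsNovikovE2

variable {p : ℕ} [Fact p.Prime] {s : ℕ} {u : ℤ}

/-- Natural numbers prime to `p` act on `E_2^{s, 2u}` through multiplication on formal groups,
which acts as the identity. -/
lemma zpow_natCast_smul {n : ℕ} (hn : IsUnit (n : ZLoc p)) (x : AdamsNovikovE2 p s u) :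
    ((hn.unit ^ u : (ZLoc p)ˣ) : ZLoc p) • x = x := by
  change Sheaf.H.map (MfgAff.omegaSMul p u _) s x = x
  rw [← MfgAff.endoOfSite_multiplication hn u]
  exact Sheaf.H_map_endoOfSite _ _ _

end AdamsNovikovE2

/-! ### Passing from units of ℤ_(p) to natural numbers. -/

section zpowSMul

variable {A M : Type*} [CommRing A] [AddCommGroup M] [Module A M]

/-- An element is fixed by a unit exactly when it is fixed by the inverse. This replaces u by |u|,
so that valuations can be computed in ℤ. -/
lemma zpow_smul_eq_iff_pow_natAbs_smul_eq (ℓ : Aˣ) (u : ℤ) (x : M) :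
    ((ℓ ^ u : Aˣ) : A) • x = x ↔ (ℓ : A) ^ u.natAbs • x = x := by
  rw [← Units.val_pow_eq_pow_val, ← Units.smul_def, ← Units.smul_def, ← zpow_natCast]
  rcases Int.natAbs_eq u with h | h
  · rw [← h]
  · rw [h, Int.natAbs_neg, Int.natAbs_natCast, zpow_neg, inv_smul_eq_iff, eq_comm]

end zpowSMul

namespace ZLoc

variable {p : ℕ} [Fact p.Prime]

lemma isUnit_intCast_iff (a : ℤ) : IsUnit (a : ZLoc p) ↔ ¬ (p : ℤ) ∣ a := by
  rw [← Ideal.mem_span_singleton]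
  have h := IsLocalization.AtPrime.isUnit_to_map_iff (ZLoc p) (Ideal.span {(p : ℤ)}) a
  rwa [eq_intCast] at h

lemma isUnit_natCast_iff (n : ℕ) : IsUnit (n : ZLoc p) ↔ ¬ p ∣ n := by
  have h := isUnit_intCast_iff (p := p) (n : ℤ)
  rwa [Int.cast_natCast, Int.natCast_dvd_natCast] at h

/-- Natural numbers are `p`-adically dense in `ℤ_(p)`. -/
lemma exists_natCast_sub_mem (ℓ : ZLoc p) (k : ℕ) : ∃ n : ℕ, (p : ZLoc p) ^ k ∣ n - ℓ := by
  have hp : p.Prime := Fact.out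
  obtain ⟨⟨a, b⟩, hab⟩ := IsLocalization.surj (Ideal.span {(p : ℤ)}).primeCompl ℓ
  have hb : ¬ (p : ℤ) ∣ b := fun h => b.2 (Ideal.mem_span_singleton.mpr h)
  -- With ℓ = a/b, Bézout makes c an inverse of b modulo p^k, so ac approximates ℓ; its remainder
  -- modulo p^k is a natural number.
  obtain ⟨c, d, hcd⟩ : IsCoprime (b : ℤ) ((p : ℤ) ^ k) :=
    (((Nat.prime_iff_prime_int.mp hp).coprime_iff_not_dvd.mpr hb).symm).pow_right
  simp only [eq_intCast] at hab
  have hpk : (p : ℤ) ^ k ≠ 0 := pow_ne_zero _ (by exact_mod_cast hp.ne_zero)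
  refine ⟨((a * c) % (p : ℤ) ^ k).toNat, ?_⟩
  have hn : ((((a * c) % (p : ℤ) ^ k).toNat : ℕ) : ℤ) = (a * c) % (p : ℤ) ^ k :=
    Int.toNat_of_nonneg (Int.emod_nonneg _ hpk)
  have hu : IsUnit ((b : ℤ) : ZLoc p) := (isUnit_intCast_iff _).mpr hb
  have hd : (p : ℤ) ^ k ∣ (((a * c) % (p : ℤ) ^ k).toNat : ℕ) * b - a := by
    rw [hn, show (a * c % (p : ℤ) ^ k) * b - a = -((a * c - a * c % (p : ℤ) ^ k) * b +
      a * d * (p : ℤ) ^ k) by linear_combination a * hcd]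
    exact (((Int.dvd_self_sub_emod).mul_right _).add (dvd_mul_left _ _)).neg_right
  rw [← hu.dvd_mul_right, sub_mul, hab]
  simpa only [map_pow, map_sub, map_mul, eq_intCast, Int.cast_natCast] using
    map_dvd (Int.castRingHom (ZLoc p)) hd

end ZLoc

/-! ### Torsion bounds from the trivial action of n^u. -/

lemma torsionExponent_le {p : ℕ} {M : Type*} [AddCommGroup M] {k : ℕ}
    (h : ∀ x : M, p ^ k • x = 0) : torsionExponent p M ≤ k :=
  iInf₂_le k h

namespace AdamsNovikovE2

variable {p : ℕ} [Fact p.Prime] {s : ℕ} {u : ℤ}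

lemma pow_natAbs_smul {n : ℕ} (hn : ¬ p ∣ n) (x : AdamsNovikovE2 p s u) :
    (n : ZLoc p) ^ u.natAbs • x = x := by
  have hn' := (ZLoc.isUnit_natCast_iff n).mpr hn
  exact (zpow_smul_eq_iff_pow_natAbs_smul_eq hn'.unit u x).mp (zpow_natCast_smul hn' x)

/-- Write n^|u| - 1 = p^k c with c prime to p. The product kills the module and c acts invertibly,
so p^k already kills it. -/
lemma pow_smul_eq_zero {n : ℕ} (hn : ¬ p ∣ n) {k : ℕ}
    (hk : emultiplicity (p : ℤ) ((n : ℤ) ^ u.natAbs - 1) = k) (x : AdamsNovikovE2 p s u) :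
    p ^ k • x = 0 := by
  obtain ⟨⟨c, hc⟩, hk'⟩ := emultiplicity_eq_coe.mp hk
  have hu : IsUnit (c : ZLoc p) := (ZLoc.isUnit_intCast_iff c).mpr fun h => hk' <| by
    rw [hc, pow_succ]
    exact mul_dvd_mul_left _ h
  have h : (((n : ℤ) ^ u.natAbs - 1 : ℤ) : ZLoc p) • x = 0 := by
    push_cast
    rw [sub_smul, one_smul, pow_natAbs_smul hn, sub_self]
  rw [hc, mul_comm, Int.cast_mul, mul_smul, hu.smul_eq_zero] at h
  rw [← Nat.cast_smul_eq_nsmul (ZLoc p)]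
  simpa using h

lemma torsionExponent_le_emultiplicity {n : ℕ} (hn : ¬ p ∣ n) :
    torsionExponent p (AdamsNovikovE2 p s u) ≤
      emultiplicity (p : ℤ) ((n : ℤ) ^ u.natAbs - 1) := by
  cases h : emultiplicity (p : ℤ) ((n : ℤ) ^ u.natAbs - 1) with
  | top => exact le_top
  | coe k => exact torsionExponent_le (pow_smul_eq_zero hn h)

lemma exists_pow_smul_eq_zero (hu : u ≠ 0) :
    ∃ k : ℕ, ∀ x : AdamsNovikovE2 p s u, p ^ k • x = 0 := by
  have hp : p.Prime := Fact.out
  -- The number 1 + p is prime to p and exceeds 1, so (1 + p)^|u| - 1 is nonzero and has finite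
  -- valuation.
  have hn : ¬ p ∣ 1 + p := by simpa using hp.one_lt.ne'
  have hfin : FiniteMultiplicity (p : ℤ) (((1 + p : ℕ) : ℤ) ^ u.natAbs - 1) := by
    refine Int.finiteMultiplicity_iff.mpr ⟨by simpa using hp.ne_one, ?_⟩
    have : 1 < (1 + p) ^ u.natAbs :=
      Nat.one_lt_pow (Int.natAbs_ne_zero.mpr hu) (by have := hp.pos; omega)
    rw [sub_ne_zero]
    exact_mod_cast this.ne'
  exact ⟨_, pow_smul_eq_zero hn hfin.emultiplicity_eq_multiplicity⟩

/-- Units `ℓ` of `ℤ_(p)` act on `E_2^{s, 2u}` through `ℓ ^ u` as the identity. -/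
lemma zpow_sub_one_smul (ℓ : (ZLoc p)ˣ) (x : AdamsNovikovE2 p s u) :
    (((ℓ ^ u : (ZLoc p)ˣ) : ZLoc p) - 1) • x = 0 := by
  -- For u = 0 there need not be a torsion bound, but ℓ^0 - 1 = 0.
  rcases eq_or_ne u 0 with rfl | hu
  · simp
  have hp : p.Prime := Fact.out
  obtain ⟨k, hk⟩ := exists_pow_smul_eq_zero (p := p) (s := s) hu
  -- The exponent k + 1 rather than k guarantees n ≡ ℓ modulo p even if k = 0, so n is prime to p.
  obtain ⟨n, hn⟩ := ZLoc.exists_natCast_sub_mem (ℓ : ZLoc p) (k + 1)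
  have hpn : ¬ p ∣ n := by
    intro h
    have h1 : (p : ZLoc p) ∣ ℓ :=
      (dvd_sub_right (map_dvd (Nat.castRingHom (ZLoc p)) h)).mp
        ((dvd_pow_self _ k.succ_ne_zero).trans hn)
    exact (ZLoc.isUnit_natCast_iff p).mp (isUnit_of_dvd_unit h1 ℓ.isUnit) dvd_rfl
  rw [sub_smul, one_smul, sub_eq_zero, zpow_smul_eq_iff_pow_natAbs_smul_eq]
  -- Since n - ℓ divides n^|u| - ℓ^|u|, this difference is a multiple of p^k and acts as zero.
  obtain ⟨c, hc⟩ := ((pow_dvd_pow (p : ZLoc p) k.le_succ).trans hn).trans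
    (sub_dvd_pow_sub_pow (n : ZLoc p) ℓ u.natAbs)
  have h0 : ((n : ZLoc p) ^ u.natAbs - (ℓ : ZLoc p) ^ u.natAbs) • x = 0 := by
    rw [hc, mul_comm, mul_smul, ← Nat.cast_pow, Nat.cast_smul_eq_nsmul, hk, smul_zero]
  rwa [sub_smul, pow_natAbs_smul hpn, sub_eq_zero, eq_comm] at h0

end AdamsNovikovE2

/-! ### Valuations of n^m - 1. -/

section arithmetic

/-- Lifting the exponent at an odd prime, starting from v_p((1 + p) - 1) = 1. -/
lemma emultiplicity_one_add_pow_sub_one {p : ℕ} (hp : p.Prime) (hp2 : p ≠ 2) (m : ℕ) :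
    emultiplicity (p : ℤ) (((1 + p : ℕ) : ℤ) ^ m - 1) = 1 + emultiplicity p m := by
  have hp' := Nat.prime_iff_prime_int.mp hp
  have h := Int.emultiplicity_pow_sub_pow hp (hp.odd_of_ne_two hp2) (x := ((1 + p : ℕ) : ℤ))
    (y := 1) (by simp) (by
      rw [Int.natCast_dvd_natCast]; simpa using hp.one_lt.ne') m
  have h1 : emultiplicity (p : ℤ) (((1 + p : ℕ) : ℤ) - 1) = 1 := by
    rw [show ((1 + p : ℕ) : ℤ) - 1 = p by push_cast; ring]
    exact (Int.finiteMultiplicity_iff.mpr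
      ⟨by simpa using hp.ne_one, hp'.ne_zero⟩).emultiplicity_self
  rwa [one_pow, h1] at h

/-- At 2, this form of lifting the exponent needs a base congruent to 1 modulo 4; 5 - 1 = 4
contributes the 2. -/
lemma emultiplicity_two_five_pow_sub_one (m : ℕ) :
    emultiplicity (2 : ℤ) ((5 : ℤ) ^ m - 1) = 2 + emultiplicity 2 m := by
  have h := Int.two_pow_sub_pow' (x := 5) (y := 1) m (by norm_num) (by norm_num)
  have h4 : emultiplicity (2 : ℤ) (5 - 1) = 2 := by
    rw [show (5 - 1 : ℤ) = 2 ^ 2 by norm_num]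
    exact emultiplicity_pow_self_of_prime Int.prime_two 2
  rw [one_pow, h4] at h
  rw [h]
  congr 1
  exact_mod_cast Int.natCast_emultiplicity 2 m

/-- The quotient (3^m - 1)/(3 - 1) is a sum of m odd terms, hence odd. -/
lemma emultiplicity_two_three_pow_sub_one {m : ℕ} (hm : Odd m) :
    emultiplicity (2 : ℤ) ((3 : ℤ) ^ m - 1) = 1 := by
  have h := emultiplicity_pow_sub_pow_of_prime Int.prime_two (x := 3) (y := 1) (n := m)
    (by norm_num) (by norm_num) (by
      have := hm.not_two_dvd_nat
      exact_mod_cast this)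
  rw [one_pow] at h
  rw [h, show (3 - 1 : ℤ) = 2 by norm_num]
  simpa using emultiplicity_pow_self_of_prime Int.prime_two 1

/-- Take n to represent a generator of the cyclic group of units modulo p, which has order p - 1. -/
lemma exists_not_dvd_pow_sub_one {p : ℕ} [Fact p.Prime] {m : ℕ} (hm : ¬ (p - 1) ∣ m) :
    ∃ n : ℕ, ¬ p ∣ n ∧ ¬ (p : ℤ) ∣ (n : ℤ) ^ m - 1 := by
  obtain ⟨g, hg⟩ := IsCyclic.exists_ofOrder_eq_natCard (α := (ZMod p)ˣ)
  rw [Nat.card_eq_fintype_card, ZMod.card_units] at hg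
  have hgn : ((g : ZMod p).val : ZMod p) = g := ZMod.natCast_zmod_val _
  refine ⟨(g : ZMod p).val, ?_, ?_⟩
  · rw [← ZMod.natCast_eq_zero_iff, hgn]
    exact g.ne_zero
  · intro h
    rw [← ZMod.intCast_zmod_eq_zero_iff_dvd] at h
    push_cast at h
    rw [hgn, sub_eq_zero] at h
    exact hm (hg ▸ orderOf_dvd_of_pow_eq_one (Units.ext (by simpa using h)))

end arithmetic

end

theorem proposition2p4 (p : ℕ) [Fact p.Prime] (s : ℕ) (u : ℤ) :
    (∀ (ℓ : (ZLoc p)ˣ) (x : AdamsNovikovE2 p s u),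
      (((ℓ ^ u : (ZLoc p)ˣ) : ZLoc p) - 1) • x = 0) ∧
    (p = 2 →
      (Odd u → torsionExponent p (AdamsNovikovE2 p s u) ≤ 1) ∧
      (Even u → torsionExponent p (AdamsNovikovE2 p s u) ≤ 2 + emultiplicity (p : ℤ) u)) ∧
    (p ≠ 2 →
      (¬ ((p : ℤ) - 1 ∣ u) → torsionExponent p (AdamsNovikovE2 p s u) = 0) ∧
      (((p : ℤ) - 1 ∣ u) →
        torsionExponent p (AdamsNovikovE2 p s u) ≤ 1 + emultiplicity (p : ℤ) u)) := by
  have hp : p.Prime := Fact.out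
  refine ⟨AdamsNovikovE2.zpow_sub_one_smul, ?_, fun hp2 => ⟨fun hu => ?_, fun _ => ?_⟩⟩
  · rintro rfl
    refine ⟨fun hu => ?_, fun _ => ?_⟩
    · refine (AdamsNovikovE2.torsionExponent_le_emultiplicity (n := 3) (by norm_num)).trans ?_
      exact (emultiplicity_two_three_pow_sub_one (Int.natAbs_odd.mpr hu)).le
    · refine (AdamsNovikovE2.torsionExponent_le_emultiplicity (n := 5) (by norm_num)).trans ?_
      -- For u = 0 both sides are infinite, in accordance with v_2(0) = ∞.
      rw [← Int.emultiplicity_natAbs 2 u]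
      exact (emultiplicity_two_five_pow_sub_one u.natAbs).le
  · have hm : ¬ (p - 1) ∣ u.natAbs := by
      rwa [← Int.natCast_dvd, Nat.cast_sub hp.one_le, Nat.cast_one]
    obtain ⟨n, hn, hnm⟩ := exists_not_dvd_pow_sub_one hm
    refine le_antisymm ((AdamsNovikovE2.torsionExponent_le_emultiplicity hn).trans ?_) zero_le
    exact (emultiplicity_eq_zero.mpr hnm).le
  · refine (AdamsNovikovE2.torsionExponent_le_emultiplicity (n := 1 + p)
      (by simpa using hp.one_lt.ne')).trans ?_
    rw [← Int.emultiplicity_natAbs p u]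
    exact (emultiplicity_one_add_pow_sub_one hp hp2 u.natAbs).le
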